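/- Let $\varphi''_F>0$ and $\varphi''_{2F}<0$ be real numbers (the second derivatives of a pair potential at $F$ and $2F$) with $A_F:=\varphi''_F+4\varphi''_{2F}>0$. For integers $N,K$ with $1\le K\le N-2$ put $\varepsilon=1/N$, let $\mathcal U=\{u\in\mathbb R^{2N+1}: u_{-N}=u_N=0\}$, $\langle v,w\rangle=\varepsilon\sum_{\ell=-N+1}^{N}v_\ell w_\ell$ and $\|v\|_{\ell^2_\varepsilon}=\langle v,v\rangle^{1/2}$. For $v\in\mathcal U$, extended by zero, and $|j|\le N-1$ write $(Lv)_j=\varepsilon^{-2}(-v_{j+1}+2v_j-v_{j-1})$ and $(L_2v)_j=\varepsilon^{-2}(-v_{j+2}+2v_j-v_{j-2})$. The linearized force-based operator on $\mathcal U$ is $$(L^{\rm qcf}v)_j=\begin{cases}\varphi''_F(Lv)_j+\varphi''_{2F}(L_2v)_j,&|j|\le K,\\ A_F(Lv)_j,&K<|j|\le N-1,\end{cases}$$ and the linearized quasi-nonlocal operator $L^{\rm qnl}$ on $\mathcal U$ is, for $j\ge0$, $$(L^{\rm qnl}v)_j=\varphi''_F(Lv)_j+\varphi''_{2F}\begin{cases}(L_2v)_j,&0\le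 j\le K-1,\\ (L_2v)_j-(Lv)_{j+1},&j=K,\\ 4(Lv)_j+(Lv)_{j-1},&j=K+1,\\ 4(Lv)_j,&K+2\le j\le N-1,\end{cases}$$ and for $j<0$ the mirror image of this formula under $j\mapsto -j$. For $\alpha\in\mathbb R$ let $G(\alpha)=I-\alpha L^{\rm qcf}$ be the iteration matrix of the Richardson iteration. Operator norms are those induced by the vector norm indicated, ${\rm cond}(S)=\|S\|_{\ell^2_\varepsilon}\|S^{-1}\|_{\ell^2_\varepsilon}$, and $\|v\|_{S^TS}=\langle S^TSv,v\rangle^{1/2}$. Then there is a constant $C>0$, independent of $N$ and $K$ (it may depend on $\varphi''_F$ and $\varphi''_{2F}$), such that for all integers $N,K$ with $1\le K\le N-2$ the following holds. The eigenvalues of $L^{\rm qnl}$, counted with multiplicity, are real and positive, $0<\lambda_1^{\rm qnl}\le\dots\le\lambda_{2N-1}^{\rm qnl}$, and there is an invertible matrix $S$ with $$L^{\rm qcf}=S^{-1}\,{\rm diag}(\lambda_1^{\rm qnl},\dots,\lambda_{2N-1}^{\rm qnl})\,S,\qquad {\rm cond}(S)\le C,$$ such that: 1. for every $\alpha\in\mathbb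 R$, $\ \|G(\alpha)\|_{S^TS}=\max_j|1-\alpha\lambda_j^{\rm qnl}|\ $ and $\ \|G(\alpha)\|_{\ell^2_\varepsilon}\le{\rm cond}(S)\max_j|1-\alpha\lambda^{\rm qnl}_j|\le C\max_j|1-\alpha\lambda_j^{\rm qnl}|$; 2. for $\alpha\in\mathbb R$, $G(\alpha)$ is a contraction in the $S^TS$-norm, i.e. $\|G(\alpha)\|_{S^TS}<1$, if and only if $0<\alpha<2/\lambda^{\rm qnl}_{2N-1}$; moreover $\|G(\alpha)\|_{\ell^2_\varepsilon}<1$ implies $0<\alpha<2/\lambda^{\rm qnl}_{2N-1}$; 3. $\alpha_{\rm opt}=2/(\lambda^{\rm qnl}_1+\lambda^{\rm qnl}_{2N-1})$ minimizes $\|G(\alpha)\|_{S^TS}$ over $\alpha\in\mathbb R$, with minimum $q=\dfrac{\lambda^{\rm qnl}_{2N-1}-\lambda^{\rm qnl}_1}{\lambda^{\rm qnl}_{2N-1}+\lambda^{\rm qnl}_1}$, and $$\|G(\alpha_{\rm opt})\|_{\ell^2_\varepsilon}\le C\,q,\qquad \|G(\alpha_{\rm opt})\|_{\ell^2_\varepsilon}\le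 C\Big(1-\frac{2A_F\varepsilon^2}{\varphi''_F}\Big),\qquad 1-C\varepsilon^2\le q\le 1-\frac{A_F\varepsilon^2}{2\varphi''_F}.$$ -/

import Mathlib

noncomputable section

/-- The lattice spacing `ε = 1 / N`. -/
def latticeEps (N : ℕ) : ℝ := 1 / (N : ℝ)

/-- The displacement space `{u ∈ ℝ^{2N+1} : u_{-N} = u_N = 0}`, written through the values at the
`2N - 1` free atoms `j = -N+1, …, N-1`; the entry with index `i` belongs to the atom
`chainSite N i = i + 1 - N`. -/
abbrev ChainDisp (N : ℕ) : Type := Fin (2 * N - 1) → ℝ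

def chainSite (N : ℕ) (i : Fin (2 * N - 1)) : ℤ := (i : ℤ) + 1 - (N : ℤ)

/-- The value `v_j` of a displacement at the atom `j`; it is `0` at `j = ±N` and beyond. -/
def chainVal (N : ℕ) (v : ChainDisp N) (j : ℤ) : ℝ :=
  if h : -(N : ℤ) < j ∧ j < (N : ℤ) then v ⟨(j + (N : ℤ) - 1).toNat, by omega⟩ else 0

theorem chainVal_add (N : ℕ) (v w : ChainDisp N) (j : ℤ) :
    chainVal N (v + w) j = chainVal N v j + chainVal N w j := by
  unfold chainVal; split <;> simp

theorem chainVal_smul (N : ℕ) (c : ℝ) (v : ChainDisp N) (j : ℤ) :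
    chainVal N (c • v) j = c * chainVal N v j := by
  unfold chainVal; split <;> simp

theorem chainVal_site (N : ℕ) (v : ChainDisp N) (i : Fin (2 * N - 1)) :
    chainVal N v (chainSite N i) = v i := by
  have h1 := i.isLt
  unfold chainVal chainSite
  rw [dif_pos (by constructor <;> omega)]
  congr 1
  ext
  simp

/-- The nearest neighbour stencil `(-w_{j+1} + 2 w_j - w_{j-1}) / ε²`. -/
def nnStencil (N : ℕ) (w : ℤ → ℝ) (j : ℤ) : ℝ :=
  (-w (j + 1) + 2 * w j - w (j - 1)) / latticeEps N ^ 2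

/-- The next-nearest neighbour stencil `(-w_{j+2} + 2 w_j - w_{j-2}) / ε²`. -/
def nnnStencil (N : ℕ) (w : ℤ → ℝ) (j : ℤ) : ℝ :=
  (-w (j + 2) + 2 * w j - w (j - 2)) / latticeEps N ^ 2

/-- The continuum elastic modulus `A_F = φ''_F + 4 φ''_{2F}`. Here and below `phiF` stands for
`φ''_F = φ''(F)` and `phi2F` for `φ''_{2F} = φ''(2F)`. -/
def elasticModulus (phiF phi2F : ℝ) : ℝ := phiF + 4 * phi2F

/-- The linearized atomistic operator at the atom `j`. -/
def atomisticStencil (phiF phi2F : ℝ) (N : ℕ) (w : ℤ → ℝ) (j : ℤ) : ℝ :=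
  phiF * nnStencil N w j + phi2F * nnnStencil N w j

/-- The linearized local quasicontinuum operator `A_F L` at the atom `j`. -/
def qclStencil (phiF phi2F : ℝ) (N : ℕ) (w : ℤ → ℝ) (j : ℤ) : ℝ :=
  elasticModulus phiF phi2F * nnStencil N w j

/-- The linearized force-based quasicontinuum operator at the atom `j`, with the atomistic region
`{-K, …, K}`. -/
def qcfStencil (phiF phi2F : ℝ) (N K : ℕ) (w : ℤ → ℝ) (j : ℤ) : ℝ :=
  if |j| ≤ (K : ℤ) then atomisticStencil phiF phi2F N w j else qclStencil phiF phi2F N w j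

/-- The linearized quasi-nonlocal quasicontinuum operator at an atom `j ≥ 0`. -/
def qnlStencilRight (phiF phi2F : ℝ) (N K : ℕ) (w : ℤ → ℝ) (j : ℤ) : ℝ :=
  phiF * nnStencil N w j + phi2F *
    (if j ≤ (K : ℤ) - 1 then nnnStencil N w j
     else if j = (K : ℤ) then nnnStencil N w j - nnStencil N w (j + 1)
     else if j = (K : ℤ) + 1 then 4 * nnStencil N w j + nnStencil N w (j - 1)
     else 4 * nnStencil N w j)

/-- The linearized quasi-nonlocal quasicontinuum operator; the formula for `j < 0` is the mirror
image (under `j ↦ -j`) of the one for `j > 0`. -/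
def qnlStencil (phiF phi2F : ℝ) (N K : ℕ) (w : ℤ → ℝ) (j : ℤ) : ℝ :=
  if 0 ≤ j then qnlStencilRight phiF phi2F N K w j
  else qnlStencilRight phiF phi2F N K (fun l => w (-l)) (-j)

/-- `L^qcf` as a linear operator on the displacement space. -/
def qcfOperator (phiF phi2F : ℝ) (N K : ℕ) : ChainDisp N →ₗ[ℝ] ChainDisp N where
  toFun v i := qcfStencil phiF phi2F N K (chainVal N v) (chainSite N i)
  map_add' v w := by
    ext i
    simp only [qcfStencil, atomisticStencil, qclStencil, nnStencil, nnnStencil, chainVal_add,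
      Pi.add_apply]
    split <;> ring
  map_smul' c v := by
    ext i
    simp only [qcfStencil, atomisticStencil, qclStencil, nnStencil, nnnStencil, chainVal_smul,
      Pi.smul_apply, smul_eq_mul, RingHom.id_apply]
    split <;> ring

/-- `L^qnl` as a linear operator on the displacement space. -/
def qnlOperator (phiF phi2F : ℝ) (N K : ℕ) : ChainDisp N →ₗ[ℝ] ChainDisp N where
  toFun v i := qnlStencil phiF phi2F N K (chainVal N v) (chainSite N i)
  map_add' v w := by
    ext i
    simp only [qnlStencil, qnlStencilRight, nnStencil, nnnStencil, chainVal_add, Pi.add_apply]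
    split_ifs <;> ring
  map_smul' c v := by
    ext i
    simp only [qnlStencil, qnlStencilRight, nnStencil, nnnStencil, chainVal_smul, Pi.smul_apply,
      smul_eq_mul, RingHom.id_apply]
    split_ifs <;> ring

abbrev ChainMatrix (N : ℕ) : Type := Matrix (Fin (2 * N - 1)) (Fin (2 * N - 1)) ℝ

/-- The matrix of `L^qcf`. -/
def qcfMatrix (phiF phi2F : ℝ) (N K : ℕ) : ChainMatrix N :=
  LinearMap.toMatrix' (qcfOperator phiF phi2F N K)

/-- The matrix of `L^qnl`. -/
def qnlMatrix (phiF phi2F : ℝ) (N K : ℕ) : ChainMatrix N :=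
  LinearMap.toMatrix' (qnlOperator phiF phi2F N K)

/-- The iteration matrix `G = I - α L^qcf` of the Richardson iteration. -/
def richardsonMatrix (phiF phi2F : ℝ) (N K : ℕ) (α : ℝ) : ChainMatrix N :=
  1 - α • qcfMatrix phiF phi2F N K

/-- `⟨v, w⟩ = ε ∑_ℓ v_ℓ w_ℓ`. -/
def epsInner (N : ℕ) (v w : ChainDisp N) : ℝ := latticeEps N * ∑ i, v i * w i

/-- The `ℓ²_ε` norm. -/
def epsNorm (N : ℕ) (v : ChainDisp N) : ℝ := Real.sqrt (epsInner N v v)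

/-- The `A`-norm `‖v‖_A = ⟨A v, v⟩^{1/2}` of a symmetric positive definite matrix `A`. -/
def energyNorm (N : ℕ) (A : ChainMatrix N) (v : ChainDisp N) : ℝ :=
  Real.sqrt (epsInner N (A.mulVec v) v)

/-- The operator norm `sup_{v ≠ 0} ‖M v‖ / ‖v‖` for a given vector norm `nrm`. -/
def opNormOf (N : ℕ) (nrm : ChainDisp N → ℝ) (M : ChainMatrix N) : ℝ :=
  sSup {r : ℝ | ∃ v : ChainDisp N, v ≠ 0 ∧ r = nrm (M.mulVec v) / nrm v}

/-- The condition number with respect to the `ℓ²_ε` norm. -/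
def epsCond (N : ℕ) (M : ChainMatrix N) : ℝ :=
  opNormOf N (epsNorm N) M * opNormOf N (epsNorm N) M⁻¹

/-- `lam 0 ≤ lam 1 ≤ …` are the eigenvalues of `M`, all of them real, in increasing order and
counted with multiplicity. -/
def IsOrderedSpectrum (N : ℕ) (M : ChainMatrix N) (lam : Fin (2 * N - 1) → ℝ) : Prop :=
  Monotone lam ∧ M.charpoly = ∏ i, (Polynomial.X - Polynomial.C (lam i))

end

/-!
Write `L` for the nearest neighbour operator and `X` for the projection onto the atomistic region.
Since `L₂ = 4 L - ε² L²`, both quasicontinuum operators factor through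
`B = A_F - φ''_{2F} ε² X L`: away from the boundary `L^qcf = B L`, and the interface corrections of
the quasi-nonlocal model are exactly those for which `L^qnl = L B`. Hence
`L^qcf = B L^qnl B⁻¹`, where `L^qnl = A_F L - φ''_{2F} ε² L X L` is symmetric, and `S` is an
orthogonal diagonalization of `L^qnl` composed with `B⁻¹`.

The condition number of `B` is bounded because `B = (1 + r) P` with `r² = 0`, where
`r = -(φ''_{2F} ε² / A_F) X L (1 - X)` and `P = A_F - φ''_{2F} ε² X L X ≥ A_F`, while
`‖L‖ ≤ 4 / ε²`. The eigenvalues of `L^qnl` are controlled by `A_F L ≤ L^qnl ≤ φ''_F L`.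
-/

section FunctionalCalculus

variable {A : Type*} [NormedRing A] [StarRing A] [PartialOrder A] [StarOrderedRing A]
  [NormedAlgebra ℝ A] [IsometricContinuousFunctionalCalculus ℝ A IsSelfAdjoint]
  [NonnegSpectrumClass ℝ A]

theorem norm_le_of_nonneg_of_le_smul_one {a : A} {c : ℝ} (hc : 0 ≤ c) (ha : 0 ≤ a)
    (hac : a ≤ c • 1) : ‖a‖ ≤ c := by
  have ha' := IsSelfAdjoint.of_nonneg ha
  rw [← Algebra.algebraMap_eq_smul_one, le_algebraMap_iff_spectrum_le] at hac
  calc ‖a‖ = ‖cfc (R := ℝ) id a‖ := by rw [cfc_id ℝ a]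
    _ ≤ c := norm_cfc_le hc fun x hx ↦ by
      rw [id, Real.norm_of_nonneg (spectrum_nonneg_of_nonneg ha hx)]; exact hac x hx

theorem exists_units_eq_and_norm_inv_le {a : A} {p : ℝ} (hp : 0 < p) (hpa : p • 1 ≤ a) :
    ∃ u : Aˣ, (u : A) = a ∧ ‖((u⁻¹ : Aˣ) : A)‖ ≤ p⁻¹ := by
  rw [← Algebra.algebraMap_eq_smul_one] at hpa
  have ha : IsSelfAdjoint a := by
    simpa using (IsSelfAdjoint.of_nonneg (sub_nonneg.2 hpa)).add (cfc_predicate_algebraMap p)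
  rw [algebraMap_le_iff_le_spectrum] at hpa
  obtain ⟨u, rfl⟩ : IsUnit a :=
    spectrum.isUnit_of_zero_notMem ℝ fun h0 ↦ (hpa 0 h0).not_gt hp
  refine ⟨u, rfl, ?_⟩
  rw [← cfc_inv_id (R := ℝ) u ha]
  refine norm_cfc_le (by positivity) fun x hx ↦ ?_
  rw [Real.norm_of_nonneg (inv_nonneg.2 (hp.le.trans (hpa x hx)))]
  exact inv_anti₀ hp (hpa x hx)

theorem mul_self_le_smul {t : A} {c : ℝ} (ht : 0 ≤ t) (htc : t ≤ c • 1) : t * t ≤ c • t := by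
  have h : 0 ≤ t * (c • 1 - t) :=
    Commute.mul_nonneg ht (sub_nonneg.2 htc) (by simp [Commute, SemiconjBy, mul_sub, sub_mul])
  rwa [mul_sub, mul_smul_comm, mul_one, sub_nonneg] at h

end FunctionalCalculus

section SquareZero

variable {A : Type*} [Ring A] [Algebra ℝ A] {x t : A} {p m : ℝ}

theorem mul_smul_one_add_smul_mul (x t : A) (p m : ℝ) :
    t * (p • 1 + m • (x * t)) = p • t + m • (t * x * t) := by
  rw [mul_add, mul_smul_comm, mul_smul_comm, mul_one, mul_assoc]

theorem smul_one_add_smul_mul_eq_of_isIdempotentElem (hx : IsIdempotentElem x) (hp : p ≠ 0) :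
    p • 1 + m • (x * t) =
      (1 + (m / p) • (x * t * (1 - x))) * (p • 1 + m • (x * t * x)) := by
  have hr : (1 - x) * (x * t * x) = 0 := by
    rw [mul_assoc, ← mul_assoc, hx.one_sub_mul_self, zero_mul]
  rw [add_mul, one_mul, smul_mul_assoc, mul_add, mul_smul_comm, mul_one, mul_smul_comm,
    mul_assoc (x * t), hr, mul_zero, smul_zero, add_zero, smul_smul, div_mul_cancel₀ _ hp,
    mul_sub, mul_one, smul_sub]
  abel

/-- The unit `1 + r`, with inverse `1 - r`, for an element `r` of square zero. -/
def unitOneAdd (r : A) (hr : r * r = 0) : Aˣ where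
  val := 1 + r
  inv := 1 - r
  val_inv := by noncomm_ring [hr]
  inv_val := by noncomm_ring [hr]

end SquareZero

section StarOrderedRing

variable {A : Type*} [Ring A] [StarRing A] [PartialOrder A] [StarOrderedRing A] [Algebra ℝ A]
  [StarModule ℝ A] {x t : A} {p m : ℝ}

theorem smul_le_mul_smul_one_add_smul_mul (hx : 0 ≤ x) (ht : IsSelfAdjoint t) (hm : 0 ≤ m) :
    p • t ≤ t * (p • 1 + m • (x * t)) := by
  rw [mul_smul_one_add_smul_mul, le_add_iff_nonneg_right]
  exact smul_nonneg hm (ht.conjugate_nonneg hx)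

end StarOrderedRing

section CStarRing

variable {A : Type*} [NormedRing A] [StarRing A] [CStarRing A] [NormedAlgebra ℝ A] {x t : A}
  {p m c : ℝ}

theorem norm_smul_one_add_smul_mul_le (hx : IsStarProjection x) (ht : ‖t‖ ≤ c)
    (hp : 0 ≤ p) (hm : 0 ≤ m) : ‖p • 1 + m • (x * t)‖ ≤ p + m * c := by
  calc ‖p • (1 : A) + m • (x * t)‖ ≤ p * ‖(1 : A)‖ + m * (‖x‖ * ‖t‖) := by
        refine (norm_add_le _ _).trans ?_
        rw [norm_smul_of_nonneg hp, norm_smul_of_nonneg hm]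
        gcongr
        exact norm_mul_le _ _
    _ ≤ p * 1 + m * (1 * c) := by
        gcongr
        exacts [(IsStarProjection.one A).norm_le, hx.norm_le]
    _ = p + m * c := by ring

end CStarRing

section Factorization

variable {A : Type*} [NormedRing A] [StarRing A] [PartialOrder A] [StarOrderedRing A]
  [NormedAlgebra ℝ A] [IsometricContinuousFunctionalCalculus ℝ A IsSelfAdjoint]
  [NonnegSpectrumClass ℝ A] [StarModule ℝ A] {x t : A} {p m c : ℝ}

theorem mul_smul_one_add_smul_mul_le (hx : x ≤ 1) (ht : 0 ≤ t) (htc : t ≤ c • 1) (hm : 0 ≤ m) :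
    t * (p • 1 + m • (x * t)) ≤ (p + m * c) • t := by
  have htxt : t * x * t ≤ c • t := by
    have h := star_left_conjugate_le_conjugate hx t
    rw [(IsSelfAdjoint.of_nonneg ht).star_eq, mul_one] at h
    exact h.trans (mul_self_le_smul ht htc)
  rw [mul_smul_one_add_smul_mul, add_smul, mul_smul]
  gcongr

theorem exists_units_eq_smul_one_add_smul_mul [CStarRing A] (hx : IsStarProjection x) (ht : 0 ≤ t)
    (htc : ‖t‖ ≤ c) (hp : 0 < p) (hm : 0 ≤ m) :
    ∃ u : Aˣ, (u : A) = p • 1 + m • (x * t) ∧ ‖((u⁻¹ : Aˣ) : A)‖ ≤ (p + m * c) / p ^ 2 := by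
  obtain ⟨s, hs, hs_inv⟩ := exists_units_eq_and_norm_inv_le (a := p • 1 + m • (x * t * x)) hp
    (le_add_of_nonneg_right (smul_nonneg hm (hx.isSelfAdjoint.conjugate_nonneg ht)))
  set r := (m / p) • (x * t * (1 - x)) with hr
  have hrr : r * r = 0 := by
    rw [hr, smul_mul_smul_comm, mul_assoc (x * t), ← mul_assoc (1 - x), ← mul_assoc (1 - x),
      hx.isIdempotentElem.one_sub_mul_self]
    simp
  have hinv : ‖(1 : A) - r‖ ≤ 1 + m / p * c :=
    calc ‖(1 : A) - r‖ ≤ ‖(1 : A)‖ + m / p * (‖x‖ * ‖t‖ * ‖1 - x‖) := by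
          refine (norm_sub_le _ _).trans ?_
          rw [hr, norm_smul_of_nonneg (by positivity)]
          gcongr
          exact norm_mul₃_le
      _ ≤ 1 + m / p * (1 * c * 1) := by
          have := (norm_nonneg t).trans htc
          gcongr
          exacts [(IsStarProjection.one A).norm_le, hx.norm_le, hx.one_sub.norm_le]
      _ = 1 + m / p * c := by ring
  refine ⟨unitOneAdd r hrr * s, ?_, ?_⟩
  · rw [smul_one_add_smul_mul_eq_of_isIdempotentElem hx.isIdempotentElem hp.ne', ← hr, ← hs]
    rfl
  · calc ‖((unitOneAdd r hrr * s)⁻¹ : Aˣ).val‖ ≤ p⁻¹ * (1 + m / p * c) := by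
          rw [mul_inv_rev]
          refine (norm_mul_le _ _).trans ?_
          gcongr
          exact hinv
      _ = (p + m * c) / p ^ 2 := by field_simp

end Factorization

section Richardson

variable {a b : ℝ}

theorem iSup_abs_one_sub_mul_eq_max {ι : Type*} [Finite ι] {lam : ι → ℝ}
    (ha : IsLeast (Set.range lam) a) (hb : IsGreatest (Set.range lam) b) (α : ℝ) :
    ⨆ j, |1 - α * lam j| = max |1 - α * a| |1 - α * b| := by
  obtain ⟨⟨i, rfl⟩, hi⟩ := ha
  obtain ⟨⟨k, rfl⟩, hk⟩ := hb
  have : Nonempty ι := ⟨i⟩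
  have hbdd : BddAbove (Set.range fun j ↦ |1 - α * lam j|) := (Set.finite_range _).bddAbove
  refine le_antisymm (ciSup_le fun j ↦ ?_) (max_le (le_ciSup hbdd i) (le_ciSup hbdd k))
  have hij : lam i ≤ lam j := hi ⟨j, rfl⟩
  have hjk : lam j ≤ lam k := hk ⟨j, rfl⟩
  rcases le_total 0 α with hα | hα
  · rw [max_comm]
    exact abs_le_max_abs_abs (by gcongr) (by gcongr)
  · exact abs_le_max_abs_abs (by linarith [mul_le_mul_of_nonpos_left hij hα])
      (by linarith [mul_le_mul_of_nonpos_left hjk hα])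

theorem max_abs_one_sub_mul_lt_one_iff (ha : 0 < a) (hab : a ≤ b) (α : ℝ) :
    max |1 - α * a| |1 - α * b| < 1 ↔ 0 < α ∧ α < 2 / b := by
  rw [max_lt_iff, abs_lt, abs_lt, lt_div_iff₀ (ha.trans_le hab)]
  constructor
  · rintro ⟨⟨-, h_low⟩, h_high, -⟩
    exact ⟨pos_of_mul_pos_left (by linarith) ha.le, by linarith⟩
  · rintro ⟨hα, hαb⟩
    have hαa : 0 < α * a := mul_pos hα ha
    have hαab : α * a ≤ α * b := by gcongr
    exact ⟨⟨by linarith, by linarith⟩, by linarith, by linarith⟩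

theorem max_abs_one_sub_two_div_add_mul (hab : a ≤ b) (hs : 0 < a + b) :
    max |1 - 2 / (a + b) * a| |1 - 2 / (a + b) * b| = (b - a) / (b + a) := by
  have h_low : 1 - 2 / (a + b) * a = (b - a) / (b + a) := by
    rw [add_comm b a]; field_simp; ring
  have h_high : 1 - 2 / (a + b) * b = -((b - a) / (b + a)) := by
    rw [add_comm b a]; field_simp; ring
  rw [h_low, h_high, abs_neg, max_self, abs_of_nonneg]
  exact div_nonneg (by linarith) (by linarith)

theorem div_add_le_max_abs_one_sub_mul (ha : 0 ≤ a) (hb : 0 < b) (α : ℝ) :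
    (b - a) / (b + a) ≤ max |1 - α * a| |1 - α * b| := by
  set M := max |1 - α * a| |1 - α * b|
  have h_low : 1 - α * a ≤ M := (le_abs_self _).trans (le_max_left _ _)
  have h_high : -(1 - α * b) ≤ M := (neg_le_abs _).trans (le_max_right _ _)
  rw [div_le_iff₀ (by linarith)]
  linarith [mul_le_mul_of_nonneg_left h_low hb.le, mul_le_mul_of_nonneg_left h_high ha]

theorem one_sub_le_sub_div_add_of_le {F p e : ℝ} (hp : 0 < p) (he : 0 < e) (ha : 0 ≤ a)
    (haF : a ≤ 3 * F) (hpb : 2 * p / e ≤ b) : 1 - 3 * (F / p) * e ≤ (b - a) / (b + a) := by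
  have hb : 0 < b := (by positivity : 0 < 2 * p / e).trans_le hpb
  have hF : 0 ≤ F := by linarith
  have h : 2 * a / (b + a) ≤ 3 * (F / p) * e := calc
    2 * a / (b + a) ≤ 2 * a / b := by gcongr; linarith
    _ ≤ 2 * (3 * F) / (2 * p / e) := by gcongr
    _ = 3 * (F / p) * e := by field_simp
  have hab : (b - a) / (b + a) = 1 - 2 * a / (b + a) := by field_simp; ring
  linarith

theorem sub_div_add_le_one_sub_of_le {F p e : ℝ} (hp : 0 < p) (hpF : p ≤ F) (he : 0 < e)
    (he1 : e ≤ 1) (hpa : 2 * p ≤ a) (hb : 0 < b) (hbF : b ≤ 4 * F / e) :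
    (b - a) / (b + a) ≤ 1 - p * e / (2 * F) := by
  have hF := hp.trans_le hpF
  rw [le_div_iff₀ he] at hbF
  have hpe : p * e ≤ F := (mul_le_of_le_one_right hp.le he1).trans hpF
  have h : p * e / (2 * F) ≤ 2 * a / (b + a) := by
    rw [div_le_div_iff₀ (by positivity) (by linarith)]
    have ha : 0 ≤ a := by linarith
    calc p * e * (b + a) = p * (b * e) + p * e * a := by ring
      _ ≤ p * (4 * F) + F * a := by gcongr
      _ ≤ 2 * a * (2 * F) := by linarith [mul_le_mul_of_nonneg_right hpa hF.le, mul_nonneg ha hF.le]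
  have hab : (b - a) / (b + a) = 1 - 2 * a / (b + a) := by
    have : b + a ≠ 0 := by linarith
    field_simp; ring
  linarith

theorem one_le_three_mul_one_sub {F p e : ℝ} (hF : 0 < F) (hpF : p ≤ F) (he : 0 ≤ e)
    (he4 : e ≤ 1 / 4) : 1 ≤ 3 * (1 - 2 * p * e / F) := by
  have h : 2 * p * e / F ≤ 2 * e := by
    rw [div_le_iff₀ hF]
    nlinarith [mul_le_mul_of_nonneg_right hpF he]
  linarith

end Richardson

section Quasicontinuum

open Matrix Finset
open scoped Matrix.Norms.L2Operator MatrixOrder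

section Matrices

variable {n : Type*}

theorem apply_diag_le_of_le {A B : Matrix n n ℝ} (h : A ≤ B) (i : n) : A i i ≤ B i i := by
  simpa using (Matrix.le_iff.1 h).diag_nonneg (i := i)

variable [Fintype n]

theorem iSup_abs_eq_norm (d : n → ℝ) : ⨆ j, |d j| = ‖d‖ := by
  refine le_antisymm (Real.iSup_le (fun j ↦ norm_le_pi_norm d j) (norm_nonneg d)) ?_
  exact (pi_norm_le_iff_of_nonneg (Real.iSup_nonneg fun j ↦ abs_nonneg _)).2 fun j ↦
    le_ciSup (f := fun j ↦ |d j|) (Set.finite_range _).bddAbove j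

variable [DecidableEq n] {A B : Matrix n n ℝ} {w : n → ℝ} {c μ : ℝ}

theorem exists_abs_sub_mul_le_of_mem_spectrum (hw : ∀ i, 0 < w i) (hμ : μ ∈ spectrum ℝ A) :
    ∃ k, |μ - A k k| * w k ≤ ∑ j ∈ univ.erase k, |A k j| * w j := by
  let W : (Matrix n n ℝ)ˣ :=
    ⟨diagonal w, diagonal w⁻¹, by simp [(hw _).ne'], by simp [(hw _).ne']⟩
  have hentry : ∀ k j, (W⁻¹.val * A * W.val) k j = (w k)⁻¹ * A k j * w j := fun k j ↦ by
    rw [show W⁻¹.val = diagonal w⁻¹ from rfl, show W.val = diagonal w from rfl, mul_diagonal,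
      diagonal_mul, Pi.inv_apply]
  rw [← spectrum.units_conjugate' (u := W), ← Matrix.spectrum_toLin',
    ← Module.End.hasEigenvalue_iff_mem_spectrum] at hμ
  obtain ⟨k, hk⟩ := eigenvalue_mem_ball hμ
  have hwk := (hw k).ne'
  have hdiag : (w k)⁻¹ * A k k * w k = A k k := by field_simp
  have hsum : ∑ j ∈ univ.erase k, |(w k)⁻¹ * A k j * w j| =
      (∑ j ∈ univ.erase k, |A k j| * w j) / w k := by
    rw [sum_div]
    refine sum_congr rfl fun j _ ↦ ?_
    rw [abs_mul, abs_mul, abs_inv, abs_of_pos (hw k), abs_of_pos (hw j)]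
    field_simp
  simp only [hentry, mem_closedBall_iff_norm, Real.norm_eq_abs, hdiag, hsum] at hk
  exact ⟨k, (le_div_iff₀ (hw k)).1 hk⟩

theorem sum_erase_abs_mul_eq (hoff : ∀ i j, i ≠ j → A i j ≤ 0) (w : n → ℝ) (i : n) :
    ∑ j ∈ univ.erase i, |A i j| * w j = A i i * w i - (A *ᵥ w) i := by
  rw [mulVec, dotProduct, ← add_sum_erase univ _ (mem_univ i), sub_add_cancel_left,
    ← sum_neg_distrib]
  refine sum_congr rfl fun j hj ↦ ?_
  rw [abs_of_nonpos (hoff i j (ne_of_mem_erase hj).symm), neg_mul]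

theorem smul_one_le_of_smul_le_mulVec (hA : A.IsHermitian) (hoff : ∀ i j, i ≠ j → A i j ≤ 0)
    (hw : ∀ i, 0 < w i) (hc : c • w ≤ A *ᵥ w) : c • 1 ≤ A := by
  rw [← Algebra.algebraMap_eq_smul_one, algebraMap_le_iff_le_spectrum (ha := hA)]
  intro μ hμ
  obtain ⟨k, hk⟩ := exists_abs_sub_mul_le_of_mem_spectrum hw hμ
  rw [sum_erase_abs_mul_eq hoff] at hk
  have hck : c * w k ≤ (A *ᵥ w) k := hc k
  have hle : (A k k - μ) * w k ≤ |μ - A k k| * w k := by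
    rw [abs_sub_comm]; gcongr; exacts [(hw k).le, le_abs_self _]
  exact le_of_mul_le_mul_right (by linarith) (hw k)

theorem le_smul_one_of_mulVec_nonneg (hA : A.IsHermitian) (hoff : ∀ i j, i ≠ j → A i j ≤ 0)
    (hw : ∀ i, 0 < w i) (hAw : 0 ≤ A *ᵥ w) (hdiag : ∀ i, A i i ≤ c) : A ≤ (2 * c) • 1 := by
  rw [← Algebra.algebraMap_eq_smul_one, le_algebraMap_iff_spectrum_le (ha := hA)]
  intro μ hμ
  obtain ⟨k, hk⟩ := exists_abs_sub_mul_le_of_mem_spectrum hw hμ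
  rw [sum_erase_abs_mul_eq hoff] at hk
  have hAwk : 0 ≤ (A *ᵥ w) k := hAw k
  have hle : |μ - A k k| ≤ A k k := le_of_mul_le_mul_right (by linarith) (hw k)
  linarith [hdiag k, le_abs_self (μ - A k k)]

theorem le_of_smul_one_le_of_mulVec_eq_smul {v : n → ℝ} (hv : v ≠ 0)
    (hc : c • 1 ≤ B) (hμ : B *ᵥ v = μ • v) : c ≤ μ := by
  have := (Matrix.le_iff.1 hc).dotProduct_mulVec_nonneg v
  rw [sub_mulVec, hμ, smul_mulVec, one_mulVec, ← sub_smul, dotProduct_smul, smul_eq_mul] at this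
  exact sub_nonneg.1 (nonneg_of_mul_nonneg_left this (dotProduct_star_self_pos_iff.2 hv))

theorem spectrum_units_conj_diagonal (S : (Matrix n n ℝ)ˣ) (d : n → ℝ) :
    spectrum ℝ (S⁻¹.val * diagonal d * S.val) = Set.range d := by
  rw [spectrum.units_conjugate', spectrum_diagonal]

theorem one_sub_smul_units_conj_diagonal (S : (Matrix n n ℝ)ˣ) (d : n → ℝ) (α : ℝ) :
    1 - α • (S⁻¹.val * diagonal d * S.val) =
      S⁻¹.val * diagonal (fun j ↦ 1 - α * d j) * S.val := by
  have : diagonal (fun j ↦ 1 - α * d j) = 1 - α • diagonal d := by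
    ext i j; by_cases h : i = j <;> simp [h, one_apply]
  rw [this, mul_sub, sub_mul, mul_one, Units.inv_mul, mul_smul_comm, smul_mul_assoc]

theorem norm_units_mul_mul_inv_diagonal (S : (Matrix n n ℝ)ˣ) (d : n → ℝ) :
    ‖S.val * (S⁻¹.val * diagonal d * S.val) * S⁻¹.val‖ = ‖d‖ := by
  rw [← l2_opNorm_diagonal (𝕜 := ℝ)]; congr 1
  simp [mul_assoc]

theorem norm_units_conj_diagonal_le (S : (Matrix n n ℝ)ˣ) (d : n → ℝ) :
    ‖S⁻¹.val * diagonal d * S.val‖ ≤ ‖S.val‖ * ‖S⁻¹.val‖ * ‖d‖ := by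
  rw [← l2_opNorm_diagonal (𝕜 := ℝ)]
  exact norm_mul₃_le.trans_eq (by ring)

theorem norm_le_norm_units_conj_diagonal (S : (Matrix n n ℝ)ˣ) (d : n → ℝ) :
    ‖d‖ ≤ ‖S⁻¹.val * diagonal d * S.val‖ := by
  refine (pi_norm_le_iff_of_nonneg (norm_nonneg _)).2 fun j ↦ ?_
  have : Nonempty n := ⟨j⟩
  have : d j ∈ spectrum ℝ (S⁻¹.val * diagonal d * S.val) := by
    rw [spectrum_units_conj_diagonal]; exact ⟨j, rfl⟩
  exact spectrum.norm_le_norm_of_mem this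

theorem charpoly_units_conj_diagonal (S : (Matrix n n ℝ)ˣ) (d : n → ℝ) :
    (S⁻¹.val * diagonal d * S.val).charpoly = ∏ i, (Polynomial.X - Polynomial.C (d i)) := by
  rw [coe_units_inv, Matrix.charpoly_units_conj', charpoly_diagonal]

theorem exists_monotone_orthogonal_diagonalization {k : ℕ} {H : Matrix (Fin k) (Fin k) ℝ}
    (hH : H.IsHermitian) :
    ∃ (lam : Fin k → ℝ) (Q : orthogonalGroup (Fin k) ℝ), Monotone lam ∧
      H = star Q.val * diagonal lam * Q.val := by
  let σ := Tuple.sort hH.eigenvalues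
  let U := hH.eigenvectorUnitary
  let Q := (star U.val).submatrix σ id
  have hstar : star Q = U.val.submatrix id σ := conjTranspose_conjTranspose _
  have hQ : Q ∈ orthogonalGroup (Fin k) ℝ := by
    rw [mem_unitaryGroup_iff, hstar, ← submatrix_mul _ _ _ _ _ Function.bijective_id,
      Unitary.coe_star_mul_self, submatrix_one_equiv]
  refine ⟨hH.eigenvalues ∘ σ, ⟨Q, hQ⟩, Tuple.monotone_sort _, ?_⟩
  change H = star Q * diagonal (hH.eigenvalues ∘ σ) * Q
  rw [hstar, ← submatrix_diagonal_equiv, submatrix_mul_equiv, submatrix_mul_equiv,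
    submatrix_id_id]
  exact hH.spectral_theorem

end Matrices

section Stencil

variable {phiF phi2F : ℝ} {N K : ℕ}

theorem nnnStencil_eq (hN : N ≠ 0) (w : ℤ → ℝ) (j : ℤ) :
    nnnStencil N w j = 4 * nnStencil N w j - latticeEps N ^ 2 * nnStencil N (nnStencil N w) j := by
  have hε : latticeEps N ≠ 0 := by simp [latticeEps, hN]
  simp only [nnnStencil, nnStencil, add_sub_cancel_right, sub_add_cancel, add_assoc, sub_sub,
    one_add_one_eq_two]
  field_simp
  ring

theorem nnStencil_comp_neg (w : ℤ → ℝ) (j : ℤ) :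
    nnStencil N (fun l ↦ w (-l)) j = nnStencil N w (-j) := by
  simp only [nnStencil, neg_add, neg_sub', sub_neg_eq_add, ← sub_eq_add_neg]
  ring

theorem qcfStencil_eq (hN : N ≠ 0) (w : ℤ → ℝ) (j : ℤ) :
    qcfStencil phiF phi2F N K w j = elasticModulus phiF phi2F * nnStencil N w j
      - phi2F * latticeEps N ^ 2 *
        (if |j| ≤ (K : ℤ) then nnStencil N (nnStencil N w) j else 0) := by
  simp only [qcfStencil, atomisticStencil, qclStencil, nnnStencil_eq hN, elasticModulus]
  split_ifs <;> ring

theorem qnlStencilRight_eq (hK : 1 ≤ K) (hN : N ≠ 0) (w : ℤ → ℝ) {j : ℤ} (hj : 0 ≤ j) :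
    qnlStencilRight phiF phi2F N K w j = elasticModulus phiF phi2F * nnStencil N w j
      - phi2F * latticeEps N ^ 2 *
        nnStencil N (fun l ↦ if |l| ≤ (K : ℤ) then nnStencil N w l else 0) j := by
  have hε : latticeEps N ≠ 0 := by simp [latticeEps, hN]
  simp only [qnlStencilRight, nnnStencil_eq hN, elasticModulus]
  rw [nnStencil.eq_def N (fun l ↦ ite _ _ _) j, nnStencil.eq_def N (nnStencil N w) j]
  generalize nnStencil N w = u
  simp only [abs_le]
  split_ifs <;> first | omega | (field_simp; ring)

theorem qnlStencil_eq (hK : 1 ≤ K) (hN : N ≠ 0) (w : ℤ → ℝ) (j : ℤ) :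
    qnlStencil phiF phi2F N K w j = elasticModulus phiF phi2F * nnStencil N w j
      - phi2F * latticeEps N ^ 2 *
        nnStencil N (fun l ↦ if |l| ≤ (K : ℤ) then nnStencil N w l else 0) j := by
  rcases le_or_gt 0 j with hj | hj
  · rw [qnlStencil, if_pos hj, qnlStencilRight_eq hK hN w hj]
  · rw [qnlStencil, if_neg hj.not_ge, qnlStencilRight_eq hK hN _ (by omega)]
    simp only [nnStencil_comp_neg w, neg_neg]
    have := nnStencil_comp_neg (N := N) (fun l ↦ if |l| ≤ (K : ℤ) then nnStencil N w l else 0) (-j)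
    simp only [abs_neg, neg_neg] at this
    rw [this]

end Stencil

section Chain

variable {N K : ℕ}

theorem latticeEps_pos (hN : N ≠ 0) : 0 < latticeEps N := by
  unfold latticeEps; positivity

theorem latticeEps_sq_le (hN : 2 ≤ N) : latticeEps N ^ 2 ≤ 1 / 4 := by
  have hN' : (2 : ℝ) ≤ N := by exact_mod_cast hN
  calc latticeEps N ^ 2 ≤ (1 / 2) ^ 2 := by unfold latticeEps; gcongr
    _ = 1 / 4 := by norm_num

theorem chainVal_of_le_abs (v : ChainDisp N) {j : ℤ} (hj : (N : ℤ) ≤ |j|) : chainVal N v j = 0 :=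
  dif_neg fun h ↦ (abs_lt.2 h).not_ge hj

theorem abs_chainSite_lt (i : Fin (2 * N - 1)) : |chainSite N i| < N := by
  rw [abs_lt, chainSite]; omega

theorem exists_chainSite_eq {j : ℤ} (hj : |j| < N) : ∃ i, chainSite N i = j := by
  rw [abs_lt] at hj
  exact ⟨⟨(j + N - 1).toNat, by omega⟩, by simp only [chainSite]; omega⟩

theorem chainSite_injective : Function.Injective (chainSite N) := fun i j h ↦ by
  simp only [chainSite] at h; omega

/-- The matrix of `L`, the nearest neighbour operator on the displacement space. -/
noncomputable def chainLaplacian (N : ℕ) : ChainMatrix N :=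
  LinearMap.toMatrix'
    { toFun := fun v i ↦ nnStencil N (chainVal N v) (chainSite N i)
      map_add' := fun v w ↦ funext fun i ↦ by
        simp only [nnStencil, chainVal_add, Pi.add_apply]; ring
      map_smul' := fun c v ↦ funext fun i ↦ by
        simp only [nnStencil, chainVal_smul, Pi.smul_apply, smul_eq_mul, RingHom.id_apply]; ring }

/-- The orthogonal projection onto the displacements supported in the atomistic region
`{-K, …, K}`. -/
noncomputable def atomisticProj (N K : ℕ) : ChainMatrix N :=
  diagonal fun i ↦ if |chainSite N i| ≤ (K : ℤ) then 1 else 0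

theorem chainLaplacian_mulVec (v : ChainDisp N) (i : Fin (2 * N - 1)) :
    (chainLaplacian N *ᵥ v) i = nnStencil N (chainVal N v) (chainSite N i) := by
  rw [chainLaplacian, LinearMap.toMatrix'_mulVec]; rfl

theorem chainVal_chainLaplacian_mulVec (v : ChainDisp N) {j : ℤ} (hj : |j| < N) :
    chainVal N (chainLaplacian N *ᵥ v) j = nnStencil N (chainVal N v) j := by
  obtain ⟨i, rfl⟩ := exists_chainSite_eq hj
  rw [chainVal_site, chainLaplacian_mulVec]

theorem atomisticProj_mulVec (v : ChainDisp N) (i : Fin (2 * N - 1)) :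
    (atomisticProj N K *ᵥ v) i = if |chainSite N i| ≤ (K : ℤ) then v i else 0 := by
  rw [atomisticProj, mulVec_diagonal, ite_mul, one_mul, zero_mul]

theorem chainVal_atomisticProj_mulVec (hKN : K < N) (v : ChainDisp N) (j : ℤ) :
    chainVal N (atomisticProj N K *ᵥ v) j = if |j| ≤ (K : ℤ) then chainVal N v j else 0 := by
  rcases lt_or_ge |j| (N : ℤ) with hj | hj
  · obtain ⟨i, rfl⟩ := exists_chainSite_eq hj
    rw [chainVal_site, chainVal_site, atomisticProj_mulVec]
  · rw [chainVal_of_le_abs _ hj, if_neg (by omega)]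

theorem isStarProjection_atomisticProj : IsStarProjection (atomisticProj N K) := by
  refine ⟨?_, isHermitian_diagonal _⟩
  rw [IsIdempotentElem, atomisticProj, diagonal_mul_diagonal]
  congr 1
  ext i
  rw [ite_mul_ite]
  simp

/-- The matrix `B` with `L^qcf = B L` and `L^qnl = L B`, where `L` is the nearest neighbour
operator. -/
noncomputable def qcfFactor (phiF phi2F : ℝ) (N K : ℕ) : ChainMatrix N :=
  elasticModulus phiF phi2F • 1
    + (-phi2F * latticeEps N ^ 2) • (atomisticProj N K * chainLaplacian N)

theorem qcfMatrix_eq (phiF phi2F : ℝ) (hKN : K + 1 < N) :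
    qcfMatrix phiF phi2F N K = qcfFactor phiF phi2F N K * chainLaplacian N := by
  refine Matrix.toLin'.injective (LinearMap.ext fun v ↦ funext fun i ↦ ?_)
  have hnn (hi : |chainSite N i| ≤ (K : ℤ)) :
      nnStencil N (chainVal N (chainLaplacian N *ᵥ v)) (chainSite N i) =
        nnStencil N (nnStencil N (chainVal N v)) (chainSite N i) := by
    rw [abs_le] at hi
    rw [nnStencil, nnStencil, chainVal_chainLaplacian_mulVec v (by rw [abs_lt]; omega),
      chainVal_chainLaplacian_mulVec v (by rw [abs_lt]; omega),
      chainVal_chainLaplacian_mulVec v (by rw [abs_lt]; omega)]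
  rw [toLin'_apply, toLin'_apply, qcfMatrix, LinearMap.toMatrix'_mulVec, ← mulVec_mulVec,
    qcfFactor, add_mulVec, smul_mulVec, smul_mulVec, one_mulVec, ← mulVec_mulVec]
  simp only [Pi.add_apply, Pi.smul_apply, smul_eq_mul, atomisticProj_mulVec,
    chainLaplacian_mulVec]
  change qcfStencil phiF phi2F N K (chainVal N v) (chainSite N i) = _
  rw [qcfStencil_eq (by omega)]
  split_ifs with hi
  · rw [hnn hi]; ring
  · ring

theorem qnlMatrix_eq (phiF phi2F : ℝ) (hK : 1 ≤ K) (hKN : K < N) :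
    qnlMatrix phiF phi2F N K = chainLaplacian N * qcfFactor phiF phi2F N K := by
  refine Matrix.toLin'.injective (LinearMap.ext fun v ↦ funext fun i ↦ ?_)
  have hproj : chainVal N (atomisticProj N K *ᵥ (chainLaplacian N *ᵥ v)) =
      fun l ↦ if |l| ≤ (K : ℤ) then nnStencil N (chainVal N v) l else 0 := by
    ext l
    rw [chainVal_atomisticProj_mulVec hKN]
    split_ifs with hl
    · exact chainVal_chainLaplacian_mulVec v (by omega)
    · rfl
  rw [toLin'_apply, toLin'_apply, qnlMatrix, LinearMap.toMatrix'_mulVec, qcfFactor, mul_add,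
    mul_smul_comm, mul_smul_comm, mul_one, add_mulVec, smul_mulVec, smul_mulVec, ← mulVec_mulVec,
    ← mulVec_mulVec]
  simp only [Pi.add_apply, Pi.smul_apply, smul_eq_mul, chainLaplacian_mulVec, hproj]
  change qnlStencil phiF phi2F N K (chainVal N v) (chainSite N i) = _
  rw [qnlStencil_eq hK (by omega)]
  ring

theorem chainVal_single (i : Fin (2 * N - 1)) :
    chainVal N (Pi.single i 1) = fun l ↦ if l = chainSite N i then 1 else 0 := by
  ext l
  rcases lt_or_ge |l| (N : ℤ) with hl | hl
  · obtain ⟨k, rfl⟩ := exists_chainSite_eq hl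
    simp only [chainVal_site, Pi.single_apply, chainSite_injective.eq_iff]
  · rw [chainVal_of_le_abs _ hl, if_neg]
    rintro rfl
    exact (abs_chainSite_lt i).not_ge hl

theorem chainLaplacian_apply (i j : Fin (2 * N - 1)) :
    chainLaplacian N i j =
      nnStencil N (fun l ↦ if l = chainSite N j then 1 else 0) (chainSite N i) := by
  rw [← chainVal_single, ← chainLaplacian_mulVec, mulVec_single_one, col_apply]

theorem chainLaplacian_apply_self (i : Fin (2 * N - 1)) :
    chainLaplacian N i i = 2 / latticeEps N ^ 2 := by
  simp [chainLaplacian_apply, nnStencil]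

theorem chainLaplacian_apply_nonpos {i j : Fin (2 * N - 1)} (hij : i ≠ j) :
    chainLaplacian N i j ≤ 0 := by
  rw [chainLaplacian_apply, nnStencil, if_neg (chainSite_injective.ne hij)]
  refine div_nonpos_of_nonpos_of_nonneg ?_ (sq_nonneg _)
  split_ifs <;> norm_num

theorem isHermitian_chainLaplacian : (chainLaplacian N).IsHermitian := by
  ext i j
  rw [conjTranspose_apply, star_trivial, chainLaplacian_apply, chainLaplacian_apply, nnStencil,
    nnStencil]
  congr 1
  split_ifs <;> first | omega | norm_num

/-- The half cosine wave `cos (π ε j / 2)`, the eigenvector of `L` for its lowest eigenvalue. -/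
noncomputable def groundState (N : ℕ) : ChainDisp N :=
  fun i ↦ Real.cos (Real.pi / 2 * latticeEps N * chainSite N i)

/-- The lowest eigenvalue of `L`. -/
noncomputable def groundEnergy (N : ℕ) : ℝ :=
  (2 - 2 * Real.cos (Real.pi / 2 * latticeEps N)) / latticeEps N ^ 2

theorem chainVal_groundState (hN : N ≠ 0) {l : ℤ} (hl : |l| ≤ N) :
    chainVal N (groundState N) l = Real.cos (Real.pi / 2 * latticeEps N * l) := by
  rcases hl.lt_or_eq with hl | hl
  · obtain ⟨i, rfl⟩ := exists_chainSite_eq hl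
    rw [chainVal_site, groundState]
  · have hNR : (N : ℝ) ≠ 0 := Nat.cast_ne_zero.2 hN
    have habs : |(l : ℝ)| = N := by exact_mod_cast hl
    rw [chainVal_of_le_abs _ hl.ge, ← Real.cos_abs, abs_mul, habs, abs_of_pos
      (mul_pos (by positivity) (latticeEps_pos hN)), latticeEps, mul_assoc, one_div_mul_cancel hNR,
      mul_one, Real.cos_pi_div_two]

theorem groundState_pos (i : Fin (2 * N - 1)) : 0 < groundState N i := by
  have hN : N ≠ 0 := by have := i.isLt; omega
  have hε := latticeEps_pos hN
  have hsite : latticeEps N * |(chainSite N i : ℝ)| < 1 := by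
    rw [latticeEps, one_div_mul_eq_div, div_lt_one (by positivity)]
    exact_mod_cast abs_chainSite_lt i
  rw [groundState, ← Real.cos_abs, abs_mul, abs_of_pos (mul_pos (by positivity) hε)]
  refine Real.cos_pos_of_mem_Ioo ⟨?_, ?_⟩
  · have : 0 ≤ Real.pi / 2 * latticeEps N * |(chainSite N i : ℝ)| := by positivity
    linarith [Real.pi_pos]
  · nlinarith [Real.pi_pos]

theorem chainLaplacian_mulVec_groundState (N : ℕ) :
    chainLaplacian N *ᵥ groundState N = groundEnergy N • groundState N := by
  ext i
  have hN : N ≠ 0 := by have := i.isLt; omega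
  have hi := abs_lt.1 (abs_chainSite_lt i)
  rw [chainLaplacian_mulVec, nnStencil, chainVal_groundState hN (abs_le.2 (by omega)),
    chainVal_groundState hN (abs_le.2 (by omega)), chainVal_groundState hN (abs_le.2 (by omega)),
    Pi.smul_apply, smul_eq_mul, groundEnergy, groundState, Int.cast_add, Int.cast_sub, Int.cast_one,
    mul_add, mul_sub, mul_one, Real.cos_add, Real.cos_sub]
  ring

theorem groundEnergy_le (hN : N ≠ 0) : groundEnergy N ≤ 3 := by
  have hε := latticeEps_pos hN
  have hcos := Real.one_sub_sq_div_two_le_cos (x := Real.pi / 2 * latticeEps N)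
  have hpi : Real.pi ^ 2 ≤ 12 := by nlinarith [Real.pi_pos, Real.pi_lt_d2]
  rw [groundEnergy, div_le_iff₀ (by positivity)]
  nlinarith [sq_pos_of_pos hε]

theorem two_le_groundEnergy (hN : 2 ≤ N) : 2 ≤ groundEnergy N := by
  have hε := latticeEps_pos (N := N) (by omega)
  have hε_le : latticeEps N ≤ 1 / 2 := by
    rw [latticeEps]; gcongr; exact_mod_cast hN
  set x := Real.pi / 2 * latticeEps N with hx
  have hx0 : 0 < x := by positivity
  have hx1 : x ≤ 1 := by nlinarith [Real.pi_lt_four]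
  have hcos := (abs_le.1 (Real.cos_bound (abs_le.2 ⟨by linarith, hx1⟩))).2
  rw [abs_of_pos hx0] at hcos
  have hx4 : x ^ 4 ≤ x ^ 2 := pow_le_pow_of_le_one hx0.le hx1 (by norm_num)
  have hεx : 9 / 4 * latticeEps N ^ 2 ≤ x ^ 2 := by
    rw [hx, mul_pow]
    gcongr
    nlinarith [Real.pi_gt_three]
  rw [groundEnergy, ← hx, le_div_iff₀ (by positivity)]
  nlinarith [sq_pos_of_pos hε]

end Chain

section EpsNorm

variable {N : ℕ}

theorem epsNorm_eq (N : ℕ) (v : ChainDisp N) :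
    epsNorm N v = √(latticeEps N) * ‖WithLp.toLp 2 v‖ := by
  have hε : 0 ≤ latticeEps N := by unfold latticeEps; positivity
  have hsq : ∑ i, v i * v i = ‖WithLp.toLp 2 v‖ ^ 2 := by
    rw [EuclideanSpace.real_norm_sq_eq]
    simp only [sq]
  rw [epsNorm, epsInner, hsq, Real.sqrt_mul hε, Real.sqrt_sq (norm_nonneg _)]

theorem epsNorm_div_epsNorm (hN : N ≠ 0) (v w : ChainDisp N) :
    epsNorm N v / epsNorm N w = ‖WithLp.toLp 2 v‖ / ‖WithLp.toLp 2 w‖ := by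
  rw [epsNorm_eq, epsNorm_eq]
  exact mul_div_mul_left _ _ (Real.sqrt_pos.2 (latticeEps_pos hN)).ne'

theorem opNormOf_epsNorm (hN : N ≠ 0) (M : ChainMatrix N) : opNormOf N (epsNorm N) M = ‖M‖ := by
  have hbound : ‖M‖ ∈ upperBounds {r : ℝ | ∃ v : ChainDisp N, v ≠ 0 ∧
      r = epsNorm N (M *ᵥ v) / epsNorm N v} := by
    rintro _ ⟨v, hv, rfl⟩
    rw [epsNorm_div_epsNorm hN, div_le_iff₀ (by simpa using hv)]
    exact M.l2_opNorm_mulVec (WithLp.toLp 2 v)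
  refine le_antisymm (Real.sSup_le hbound (norm_nonneg _)) ?_
  rw [cstar_norm_def]
  refine ContinuousLinearMap.opNorm_le_bound _ (Real.sSup_nonneg ?_) fun x ↦ ?_
  · rintro _ ⟨v, -, rfl⟩
    rw [epsNorm_div_epsNorm hN]
    positivity
  · rcases eq_or_ne x 0 with rfl | hx
    · simp
    · rw [← div_le_iff₀ (norm_pos_iff.2 hx)]
      refine le_csSup ⟨_, hbound⟩ ⟨x.ofLp, by simpa using hx, ?_⟩
      rw [epsNorm_div_epsNorm hN]
      rfl

theorem epsCond_units (hN : N ≠ 0) (S : (ChainMatrix N)ˣ) :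
    epsCond N S.val = ‖S.val‖ * ‖S⁻¹.val‖ := by
  rw [epsCond, opNormOf_epsNorm hN, opNormOf_epsNorm hN, coe_units_inv]

theorem energyNorm_transpose_mul_self (S : ChainMatrix N) (v : ChainDisp N) :
    energyNorm N (Sᵀ * S) v = epsNorm N (S *ᵥ v) := by
  have h : ((Sᵀ * S) *ᵥ v) ⬝ᵥ v = (S *ᵥ v) ⬝ᵥ (S *ᵥ v) := by
    rw [dotProduct_comm, ← mulVec_mulVec, dotProduct_mulVec, vecMul_transpose]
  exact congrArg (fun t ↦ √(latticeEps N * t)) h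

theorem opNormOf_energyNorm (hN : N ≠ 0) (S : (ChainMatrix N)ˣ) (M : ChainMatrix N) :
    opNormOf N (energyNorm N (S.valᵀ * S.val)) M = ‖S.val * M * S⁻¹.val‖ := by
  have hSS (v : ChainDisp N) : S.val *ᵥ (S⁻¹.val *ᵥ v) = v := by
    rw [mulVec_mulVec, Units.mul_inv, one_mulVec]
  have hSS' (v : ChainDisp N) : S⁻¹.val *ᵥ (S.val *ᵥ v) = v := by
    rw [mulVec_mulVec, Units.inv_mul, one_mulVec]
  rw [← opNormOf_epsNorm hN, opNormOf, opNormOf]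
  congr 1
  ext r
  simp only [energyNorm_transpose_mul_self, ← mulVec_mulVec, Set.mem_ofPred_eq]
  constructor
  · rintro ⟨v, hv, rfl⟩
    refine ⟨S.val *ᵥ v, fun h ↦ hv ?_, ?_⟩
    · rw [← hSS' v, h, mulVec_zero]
    · rw [hSS']
  · rintro ⟨v, hv, rfl⟩
    refine ⟨S⁻¹.val *ᵥ v, fun h ↦ hv ?_, ?_⟩
    · rw [← hSS v, h, mulVec_zero]
    · rw [hSS]

end EpsNorm

section Bounds

variable {N K : ℕ} {phiF phi2F : ℝ}

theorem groundEnergy_nonneg (N : ℕ) : 0 ≤ groundEnergy N :=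
  div_nonneg (by linarith [Real.cos_le_one (Real.pi / 2 * latticeEps N)]) (sq_nonneg _)

theorem groundEnergy_smul_one_le_chainLaplacian (N : ℕ) :
    groundEnergy N • 1 ≤ chainLaplacian N :=
  smul_one_le_of_smul_le_mulVec isHermitian_chainLaplacian
    (fun _ _ ↦ chainLaplacian_apply_nonpos) groundState_pos
    (chainLaplacian_mulVec_groundState N).ge

theorem chainLaplacian_nonneg (N : ℕ) : 0 ≤ chainLaplacian N :=
  (smul_nonneg (groundEnergy_nonneg N) zero_le_one).trans
    (groundEnergy_smul_one_le_chainLaplacian N)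

theorem chainLaplacian_le (N : ℕ) : chainLaplacian N ≤ (4 / latticeEps N ^ 2) • 1 := by
  have h := le_smul_one_of_mulVec_nonneg isHermitian_chainLaplacian
    (fun i j ↦ chainLaplacian_apply_nonpos (i := i) (j := j)) groundState_pos
    (chainLaplacian_mulVec_groundState N ▸
      smul_nonneg (groundEnergy_nonneg N) fun i ↦ (groundState_pos i).le)
    fun i ↦ (chainLaplacian_apply_self i).le
  rwa [show 2 * (2 / latticeEps N ^ 2) = 4 / latticeEps N ^ 2 by ring] at h

theorem norm_chainLaplacian_le (N : ℕ) : ‖chainLaplacian N‖ ≤ 4 / latticeEps N ^ 2 :=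
  norm_le_of_nonneg_of_le_smul_one (by positivity) (chainLaplacian_nonneg N) (chainLaplacian_le N)

theorem elasticModulus_le (hphi2F : phi2F ≤ 0) : elasticModulus phiF phi2F ≤ phiF := by
  rw [elasticModulus]; linarith

theorem elasticModulus_add_mul_eq_phiF (hN : N ≠ 0) :
    elasticModulus phiF phi2F + -phi2F * latticeEps N ^ 2 * (4 / latticeEps N ^ 2) = phiF := by
  have hε := (latticeEps_pos hN).ne'
  rw [elasticModulus]
  field_simp
  ring

theorem exists_units_eq_qcfFactor (hN : N ≠ 0) (hphi2F : phi2F ≤ 0)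
    (hA : 0 < elasticModulus phiF phi2F) :
    ∃ B : (ChainMatrix N)ˣ, B.val = qcfFactor phiF phi2F N K ∧ ‖B.val‖ ≤ phiF ∧
      ‖B⁻¹.val‖ ≤ phiF / elasticModulus phiF phi2F ^ 2 := by
  have hm : 0 ≤ -phi2F * latticeEps N ^ 2 := mul_nonneg (neg_nonneg.2 hphi2F) (sq_nonneg _)
  have hproj : IsStarProjection (atomisticProj N K) := isStarProjection_atomisticProj
  obtain ⟨B, hB, hB_inv⟩ := exists_units_eq_smul_one_add_smul_mul hproj
    (chainLaplacian_nonneg N) (norm_chainLaplacian_le N) hA hm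
  have hB_norm := norm_smul_one_add_smul_mul_le hproj (norm_chainLaplacian_le N) hA.le hm
  rw [elasticModulus_add_mul_eq_phiF hN] at hB_inv hB_norm
  exact ⟨B, hB, hB ▸ hB_norm, hB_inv⟩

theorem elasticModulus_smul_le_qnlMatrix (hphi2F : phi2F ≤ 0) (hK : 1 ≤ K) (hKN : K < N) :
    elasticModulus phiF phi2F • chainLaplacian N ≤ qnlMatrix phiF phi2F N K := by
  rw [qnlMatrix_eq phiF phi2F hK hKN, qcfFactor]
  exact smul_le_mul_smul_one_add_smul_mul isStarProjection_atomisticProj.nonneg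
    isHermitian_chainLaplacian (mul_nonneg (neg_nonneg.2 hphi2F) (sq_nonneg _))

theorem qnlMatrix_le_smul (hphi2F : phi2F ≤ 0) (hK : 1 ≤ K) (hKN : K < N) :
    qnlMatrix phiF phi2F N K ≤ phiF • chainLaplacian N := by
  rw [qnlMatrix_eq phiF phi2F hK hKN, qcfFactor]
  have h := mul_smul_one_add_smul_mul_le (p := elasticModulus phiF phi2F)
    (isStarProjection_atomisticProj (N := N) (K := K)).le_one (chainLaplacian_nonneg N)
    (chainLaplacian_le N) (mul_nonneg (neg_nonneg.2 hphi2F) (sq_nonneg (latticeEps N)))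
  rwa [elasticModulus_add_mul_eq_phiF (by omega)] at h

theorem isHermitian_qnlMatrix (hK : 1 ≤ K) (hKN : K < N) :
    (qnlMatrix phiF phi2F N K).IsHermitian := by
  have hL : star (chainLaplacian N) = chainLaplacian N := isHermitian_chainLaplacian
  have hx : star (atomisticProj N K) = atomisticProj N K :=
    isStarProjection_atomisticProj.isSelfAdjoint
  rw [qnlMatrix_eq phiF phi2F hK hKN, qcfFactor, mul_smul_one_add_smul_mul, IsHermitian,
    ← star_eq_conjTranspose]
  simp [hL, hx, mul_assoc]

theorem exists_qcfMatrix_diagonalization (hK : 1 ≤ K) (hKN : K + 1 < N) (hphi2F : phi2F ≤ 0)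
    (hA : 0 < elasticModulus phiF phi2F) :
    ∃ (lam : Fin (2 * N - 1) → ℝ) (S : (ChainMatrix N)ˣ),
      IsOrderedSpectrum N (qnlMatrix phiF phi2F N K) lam ∧
      qcfMatrix phiF phi2F N K = S⁻¹.val * diagonal lam * S.val ∧
      epsCond N S.val ≤ (phiF / elasticModulus phiF phi2F) ^ 2 := by
  obtain ⟨B, hB, hB_norm, hB_inv⟩ :=
    exists_units_eq_qcfFactor (N := N) (K := K) (by omega) hphi2F hA
  obtain ⟨lam, Q, hlam, hQ⟩ := exists_monotone_orthogonal_diagonalization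
    (isHermitian_qnlMatrix (phiF := phiF) (phi2F := phi2F) hK (Nat.lt_of_succ_lt hKN))
  refine ⟨lam, Unitary.toUnits Q * B⁻¹, ⟨hlam, ?_⟩, ?_, ?_⟩
  · rw [hQ]
    exact charpoly_units_conj_diagonal (Unitary.toUnits Q) lam
  · have hB_conj : qcfMatrix phiF phi2F N K = B.val * qnlMatrix phiF phi2F N K * B⁻¹.val := by
      rw [qcfMatrix_eq phiF phi2F hKN, qnlMatrix_eq phiF phi2F hK (by omega), ← hB, ← mul_assoc,
        Units.mul_inv_cancel_right]
    rw [hB_conj, hQ]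
    simp [mul_assoc]
  · have hS : ‖(Unitary.toUnits Q * B⁻¹).val‖ = ‖B⁻¹.val‖ :=
      CStarRing.norm_coe_unitary_mul Q B⁻¹.val
    have hS_inv : ‖(Unitary.toUnits Q * B⁻¹)⁻¹.val‖ = ‖B.val‖ := by
      rw [_root_.mul_inv_rev, inv_inv]
      exact CStarRing.norm_mul_coe_unitary B.val Q⁻¹
    rw [epsCond_units (by omega), hS, hS_inv, mul_comm]
    have hphiF : 0 ≤ phiF := (norm_nonneg _).trans hB_norm
    calc ‖B.val‖ * ‖B⁻¹.val‖ ≤ phiF * (phiF / elasticModulus phiF phi2F ^ 2) := by gcongr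
      _ = (phiF / elasticModulus phiF phi2F) ^ 2 := by ring

theorem IsOrderedSpectrum.spectrum_eq {M : ChainMatrix N} {lam : Fin (2 * N - 1) → ℝ}
    (h : IsOrderedSpectrum N M lam) : spectrum ℝ M = Set.range lam := by
  ext μ
  rw [Matrix.mem_spectrum_iff_isRoot_charpoly, h.2, Polynomial.IsRoot, Polynomial.eval_prod]
  simp [prod_eq_zero_iff, sub_eq_zero, eq_comm (a := μ)]

theorem IsOrderedSpectrum.isLeast {M : ChainMatrix N} {lam : Fin (2 * N - 1) → ℝ}
    (h : IsOrderedSpectrum N M lam) (hN : 0 < 2 * N - 1) :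
    IsLeast (Set.range lam) (lam ⟨0, hN⟩) :=
  ⟨⟨_, rfl⟩, Set.forall_mem_range.2 fun j ↦ h.1 (Fin.mk_le_of_le_val (Nat.zero_le j))⟩

theorem IsOrderedSpectrum.isGreatest {M : ChainMatrix N} {lam : Fin (2 * N - 1) → ℝ}
    (h : IsOrderedSpectrum N M lam) (hN : 2 * N - 2 < 2 * N - 1) :
    IsGreatest (Set.range lam) (lam ⟨2 * N - 2, hN⟩) :=
  ⟨⟨_, rfl⟩, Set.forall_mem_range.2 fun j ↦ h.1 (Fin.le_def.2 (Nat.le_sub_one_of_lt j.isLt))⟩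

theorem two_mul_elasticModulus_le_of_mem_spectrum {μ : ℝ} (hK : 1 ≤ K) (hKN : K < N)
    (hphi2F : phi2F ≤ 0) (hA : 0 ≤ elasticModulus phiF phi2F)
    (hμ : μ ∈ spectrum ℝ (qnlMatrix phiF phi2F N K)) : 2 * elasticModulus phiF phi2F ≤ μ := by
  refine (algebraMap_le_iff_le_spectrum (isHermitian_qnlMatrix hK hKN)).1 ?_ μ hμ
  have hL : (2 : ℝ) • 1 ≤ chainLaplacian N :=
    (smul_le_smul_of_nonneg_right (two_le_groundEnergy (by omega)) zero_le_one).trans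
      (groundEnergy_smul_one_le_chainLaplacian N)
  calc algebraMap ℝ (ChainMatrix N) (2 * elasticModulus phiF phi2F)
      = elasticModulus phiF phi2F • (2 : ℝ) • 1 := by
        rw [Algebra.algebraMap_eq_smul_one, smul_smul, mul_comm (2 : ℝ)]
    _ ≤ elasticModulus phiF phi2F • chainLaplacian N := smul_le_smul_of_nonneg_left hL hA
    _ ≤ qnlMatrix phiF phi2F N K := elasticModulus_smul_le_qnlMatrix hphi2F hK hKN

theorem le_div_latticeEps_sq_of_mem_spectrum {μ : ℝ} (hK : 1 ≤ K) (hKN : K < N)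
    (hphiF : 0 ≤ phiF) (hphi2F : phi2F ≤ 0) (hμ : μ ∈ spectrum ℝ (qnlMatrix phiF phi2F N K)) :
    μ ≤ 4 * phiF / latticeEps N ^ 2 := by
  refine (le_algebraMap_iff_spectrum_le (isHermitian_qnlMatrix hK hKN)).1 ?_ μ hμ
  calc qnlMatrix phiF phi2F N K ≤ phiF • chainLaplacian N := qnlMatrix_le_smul hphi2F hK hKN
    _ ≤ phiF • (4 / latticeEps N ^ 2) • 1 := smul_le_smul_of_nonneg_left (chainLaplacian_le N) hphiF
    _ = algebraMap ℝ (ChainMatrix N) (4 * phiF / latticeEps N ^ 2) := by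
        rw [Algebra.algebraMap_eq_smul_one, smul_smul, mul_div_assoc', mul_comm phiF]

theorem le_three_mul_of_mem_lowerBounds_spectrum {a : ℝ} (hK : 1 ≤ K) (hKN : K < N)
    (hphiF : 0 ≤ phiF) (hphi2F : phi2F ≤ 0)
    (ha : a ∈ lowerBounds (spectrum ℝ (qnlMatrix phiF phi2F N K))) : a ≤ 3 * phiF := by
  have haL : a • 1 ≤ phiF • chainLaplacian N := by
    rw [← Algebra.algebraMap_eq_smul_one]
    exact ((algebraMap_le_iff_le_spectrum (isHermitian_qnlMatrix hK hKN)).2 ha).trans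
      (qnlMatrix_le_smul hphi2F hK hKN)
  have hground : groundState N ≠ 0 := fun h ↦
    (groundState_pos (N := N) ⟨0, by omega⟩).ne' (congrFun h _)
  have ha_ground : a ≤ phiF * groundEnergy N :=
    le_of_smul_one_le_of_mulVec_eq_smul hground haL <| by
      rw [smul_mulVec, chainLaplacian_mulVec_groundState, smul_smul]
  calc a ≤ phiF * groundEnergy N := ha_ground
    _ ≤ phiF * 3 := by gcongr; exact groundEnergy_le (by omega)
    _ = 3 * phiF := mul_comm _ _

theorem div_latticeEps_sq_le_of_mem_upperBounds_spectrum {b : ℝ} (hK : 1 ≤ K) (hKN : K < N)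
    (hphi2F : phi2F ≤ 0) (hb : b ∈ upperBounds (spectrum ℝ (qnlMatrix phiF phi2F N K))) :
    2 * elasticModulus phiF phi2F / latticeEps N ^ 2 ≤ b := by
  have hLb : elasticModulus phiF phi2F • chainLaplacian N ≤ b • 1 := by
    rw [← Algebra.algebraMap_eq_smul_one]
    exact (elasticModulus_smul_le_qnlMatrix hphi2F hK hKN).trans
      ((le_algebraMap_iff_spectrum_le (isHermitian_qnlMatrix hK hKN)).2 hb)
  have hdiag := apply_diag_le_of_le hLb ⟨0, by omega⟩
  rwa [Matrix.smul_apply, Matrix.smul_apply, one_apply_eq, chainLaplacian_apply_self,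
    smul_eq_mul, smul_eq_mul, mul_one, mul_div_assoc', mul_comm _ (2 : ℝ)] at hdiag

end Bounds

section RichardsonNorm

variable {N : ℕ} {M : ChainMatrix N} {S : (ChainMatrix N)ˣ}
  {lam : Fin (2 * N - 1) → ℝ} {a b : ℝ}

theorem opNormOf_energyNorm_one_sub_smul (hN : N ≠ 0) (hM : M = S⁻¹.val * diagonal lam * S.val)
    (α : ℝ) :
    opNormOf N (energyNorm N (S.valᵀ * S.val)) (1 - α • M) = ⨆ j, |1 - α * lam j| := by
  rw [opNormOf_energyNorm hN, hM, one_sub_smul_units_conj_diagonal,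
    norm_units_mul_mul_inv_diagonal, iSup_abs_eq_norm fun j ↦ 1 - α * lam j]

theorem opNormOf_epsNorm_one_sub_smul_le (hN : N ≠ 0) (hM : M = S⁻¹.val * diagonal lam * S.val)
    {c : ℝ} (hc : epsCond N S.val ≤ c) (α : ℝ) :
    opNormOf N (epsNorm N) (1 - α • M) ≤ c * ⨆ j, |1 - α * lam j| := by
  rw [epsCond_units hN] at hc
  rw [opNormOf_epsNorm hN, hM, one_sub_smul_units_conj_diagonal,
    iSup_abs_eq_norm fun j ↦ 1 - α * lam j]
  exact (norm_units_conj_diagonal_le _ _).trans (mul_le_mul_of_nonneg_right hc (norm_nonneg _))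

theorem iSup_le_opNormOf_epsNorm_one_sub_smul (hN : N ≠ 0)
    (hM : M = S⁻¹.val * diagonal lam * S.val) (α : ℝ) :
    ⨆ j, |1 - α * lam j| ≤ opNormOf N (epsNorm N) (1 - α • M) := by
  rw [opNormOf_epsNorm hN, hM, one_sub_smul_units_conj_diagonal,
    iSup_abs_eq_norm fun j ↦ 1 - α * lam j]
  exact norm_le_norm_units_conj_diagonal _ _

theorem opNormOf_energyNorm_one_sub_smul_lt_one_iff (hN : N ≠ 0)
    (hM : M = S⁻¹.val * diagonal lam * S.val) (ha : IsLeast (Set.range lam) a)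
    (hb : IsGreatest (Set.range lam) b) (ha_pos : 0 < a) {α : ℝ} :
    opNormOf N (energyNorm N (S.valᵀ * S.val)) (1 - α • M) < 1 ↔ 0 < α ∧ α < 2 / b := by
  rw [opNormOf_energyNorm_one_sub_smul hN hM, iSup_abs_one_sub_mul_eq_max ha hb,
    max_abs_one_sub_mul_lt_one_iff ha_pos (ha.2 hb.1)]

theorem pos_and_lt_two_div_of_opNormOf_epsNorm_one_sub_smul_lt_one (hN : N ≠ 0)
    (hM : M = S⁻¹.val * diagonal lam * S.val) (ha : IsLeast (Set.range lam) a)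
    (hb : IsGreatest (Set.range lam) b) (ha_pos : 0 < a) {α : ℝ}
    (hα : opNormOf N (epsNorm N) (1 - α • M) < 1) : 0 < α ∧ α < 2 / b := by
  rw [← max_abs_one_sub_mul_lt_one_iff ha_pos (ha.2 hb.1), ← iSup_abs_one_sub_mul_eq_max ha hb]
  exact (iSup_le_opNormOf_epsNorm_one_sub_smul hN hM α).trans_lt hα

theorem iSup_abs_one_sub_two_div_add_mul (ha : IsLeast (Set.range lam) a)
    (hb : IsGreatest (Set.range lam) b) (ha_pos : 0 < a) :
    ⨆ j, |1 - 2 / (a + b) * lam j| = (b - a) / (b + a) := by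
  have hab : a ≤ b := ha.2 hb.1
  rw [iSup_abs_one_sub_mul_eq_max ha hb, max_abs_one_sub_two_div_add_mul hab (by linarith)]

theorem div_add_le_iSup_abs_one_sub_mul (ha : IsLeast (Set.range lam) a)
    (hb : IsGreatest (Set.range lam) b) (ha_pos : 0 < a) (α : ℝ) :
    (b - a) / (b + a) ≤ ⨆ j, |1 - α * lam j| := by
  rw [iSup_abs_one_sub_mul_eq_max ha hb]
  exact div_add_le_max_abs_one_sub_mul ha_pos.le (ha_pos.trans_le (ha.2 hb.1)) α

end RichardsonNorm

section QcfRichardson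

variable {N K : ℕ} {phiF phi2F a b : ℝ} {lam : Fin (2 * N - 1) → ℝ}

theorem IsOrderedSpectrum.pos_of_qnlMatrix
    (hlam : IsOrderedSpectrum N (qnlMatrix phiF phi2F N K) lam) (hK : 1 ≤ K) (hKN : K < N)
    (hphi2F : phi2F ≤ 0) (hA : 0 < elasticModulus phiF phi2F) (j : Fin (2 * N - 1)) :
    0 < lam j := by
  have hj : lam j ∈ spectrum ℝ (qnlMatrix phiF phi2F N K) := hlam.spectrum_eq ▸ ⟨j, rfl⟩
  linarith [two_mul_elasticModulus_le_of_mem_spectrum hK hKN hphi2F hA.le hj]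

theorem IsOrderedSpectrum.one_sub_le_sub_div_add
    (hlam : IsOrderedSpectrum N (qnlMatrix phiF phi2F N K) lam) (hK : 1 ≤ K) (hKN : K < N)
    (hphi2F : phi2F ≤ 0) (hA : 0 < elasticModulus phiF phi2F)
    (ha : IsLeast (Set.range lam) a) (hb : IsGreatest (Set.range lam) b) :
    1 - 3 * (phiF / elasticModulus phiF phi2F) * latticeEps N ^ 2 ≤ (b - a) / (b + a) := by
  rw [← hlam.spectrum_eq] at ha hb
  have hε := latticeEps_pos (N := N) (by omega)
  have ha_ge := two_mul_elasticModulus_le_of_mem_spectrum hK hKN hphi2F hA.le ha.1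
  exact one_sub_le_sub_div_add_of_le hA (by positivity) (by linarith)
    (le_three_mul_of_mem_lowerBounds_spectrum hK hKN
      (hA.le.trans (elasticModulus_le hphi2F)) hphi2F ha.2)
    (div_latticeEps_sq_le_of_mem_upperBounds_spectrum hK hKN hphi2F hb.2)

theorem IsOrderedSpectrum.sub_div_add_le_one_sub
    (hlam : IsOrderedSpectrum N (qnlMatrix phiF phi2F N K) lam) (hK : 1 ≤ K) (hKN : K < N)
    (hphi2F : phi2F ≤ 0) (hA : 0 < elasticModulus phiF phi2F)
    (ha : a ∈ Set.range lam) (hb : b ∈ Set.range lam) :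
    (b - a) / (b + a) ≤ 1 - elasticModulus phiF phi2F * latticeEps N ^ 2 / (2 * phiF) := by
  rw [← hlam.spectrum_eq] at ha hb
  have hε := latticeEps_pos (N := N) (by omega)
  have hpF := elasticModulus_le (phiF := phiF) hphi2F
  have hb_ge := two_mul_elasticModulus_le_of_mem_spectrum hK hKN hphi2F hA.le hb
  exact sub_div_add_le_one_sub_of_le hA hpF (by positivity)
    ((latticeEps_sq_le (N := N) (by omega)).trans (by norm_num))
    (two_mul_elasticModulus_le_of_mem_spectrum hK hKN hphi2F hA.le ha) (by linarith)
    (le_div_latticeEps_sq_of_mem_spectrum hK hKN (hA.le.trans hpF) hphi2F hb)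

theorem IsOrderedSpectrum.sub_div_add_le_three_mul_one_sub
    (hlam : IsOrderedSpectrum N (qnlMatrix phiF phi2F N K) lam) (hK : 1 ≤ K) (hKN : K < N)
    (hphi2F : phi2F ≤ 0) (hA : 0 < elasticModulus phiF phi2F)
    (ha : a ∈ Set.range lam) (hb : b ∈ Set.range lam) :
    (b - a) / (b + a) ≤ 3 * (1 - 2 * elasticModulus phiF phi2F * latticeEps N ^ 2 / phiF) := by
  have hpF := elasticModulus_le (phiF := phiF) hphi2F
  have hphiF := hA.trans_le hpF
  calc (b - a) / (b + a)
      ≤ 1 - elasticModulus phiF phi2F * latticeEps N ^ 2 / (2 * phiF) :=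
        hlam.sub_div_add_le_one_sub hK hKN hphi2F hA ha hb
    _ ≤ 1 := sub_le_self _ (by positivity)
    _ ≤ 3 * (1 - 2 * elasticModulus phiF phi2F * latticeEps N ^ 2 / phiF) :=
        one_le_three_mul_one_sub hphiF hpF (sq_nonneg _) (latticeEps_sq_le (by omega))

end QcfRichardson

end Quasicontinuum

theorem mainTheorem8 (phiF phi2F : ℝ) (hphiF : 0 < phiF) (hphi2F : phi2F < 0)
    (hA : 0 < elasticModulus phiF phi2F) :
    ∃ C : ℝ, 0 < C ∧ ∀ (N K : ℕ) (_ : 1 ≤ K) (hKN : K + 2 ≤ N),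
      ∃ (lam : Fin (2 * N - 1) → ℝ) (S : ChainMatrix N),
        IsOrderedSpectrum N (qnlMatrix phiF phi2F N K) lam ∧
        (∀ j, 0 < lam j) ∧
        IsUnit S.det ∧
        qcfMatrix phiF phi2F N K = S⁻¹ * Matrix.diagonal lam * S ∧
        epsCond N S ≤ C ∧
        (∀ α : ℝ,
          opNormOf N (energyNorm N (S.transpose * S)) (richardsonMatrix phiF phi2F N K α)
              = ⨆ j, |1 - α * lam j| ∧
          opNormOf N (epsNorm N) (richardsonMatrix phiF phi2F N K α)
              ≤ epsCond N S * ⨆ j, |1 - α * lam j| ∧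
          opNormOf N (epsNorm N) (richardsonMatrix phiF phi2F N K α)
              ≤ C * ⨆ j, |1 - α * lam j|) ∧
        (∀ lam₁ lamMax : ℝ, lam₁ = lam ⟨0, by omega⟩ → lamMax = lam ⟨2 * N - 2, by omega⟩ →
          (∀ α : ℝ,
            opNormOf N (energyNorm N (S.transpose * S)) (richardsonMatrix phiF phi2F N K α) < 1
              ↔ 0 < α ∧ α < 2 / lamMax) ∧
          (∀ α : ℝ,
            opNormOf N (epsNorm N) (richardsonMatrix phiF phi2F N K α) < 1
              → 0 < α ∧ α < 2 / lamMax) ∧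
          (∀ αopt q : ℝ, αopt = 2 / (lam₁ + lamMax) →
            q = (lamMax - lam₁) / (lamMax + lam₁) →
            opNormOf N (energyNorm N (S.transpose * S))
                (richardsonMatrix phiF phi2F N K αopt) = q ∧
            (∀ α : ℝ, q ≤ opNormOf N (energyNorm N (S.transpose * S))
                (richardsonMatrix phiF phi2F N K α)) ∧
            opNormOf N (epsNorm N) (richardsonMatrix phiF phi2F N K αopt) ≤ C * q ∧
            opNormOf N (epsNorm N) (richardsonMatrix phiF phi2F N K αopt)
              ≤ C * (1 - 2 * elasticModulus phiF phi2F * latticeEps N ^ 2 / phiF) ∧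
            1 - C * latticeEps N ^ 2 ≤ q ∧
            q ≤ 1 - elasticModulus phiF phi2F * latticeEps N ^ 2 / (2 * phiF))) := by
  set κ := phiF / elasticModulus phiF phi2F
  have hκ : 1 ≤ κ := (one_le_div hA).2 (elasticModulus_le hphi2F.le)
  have hκ_C : κ ^ 2 ≤ 3 * κ ^ 2 := by linarith [sq_nonneg κ]
  refine ⟨3 * κ ^ 2, by positivity, fun N K hK hKN ↦ ?_⟩
  have hN : N ≠ 0 := by omega
  have hK_lt : K < N := by omega
  obtain ⟨lam, S, hlam, hqcf, (hcond : _ ≤ κ ^ 2)⟩ :=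
    exists_qcfMatrix_diagonalization hK hKN hphi2F.le hA
  have hpos := hlam.pos_of_qnlMatrix hK hK_lt hphi2F.le hA
  have ha := hlam.isLeast (by omega)
  have hb := hlam.isGreatest (by omega)
  have henergy := opNormOf_energyNorm_one_sub_smul hN hqcf
  have heps {c} (hc) := opNormOf_epsNorm_one_sub_smul_le (c := c) hN hqcf hc
  refine ⟨lam, S.val, hlam, hpos, (Matrix.isUnit_iff_isUnit_det _).1 S.isUnit,
    Matrix.coe_units_inv S ▸ hqcf, hcond.trans hκ_C,
    fun α ↦ ⟨henergy α, heps le_rfl α, heps (hcond.trans hκ_C) α⟩, ?_⟩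
  rintro _ _ rfl rfl
  refine ⟨fun α ↦ opNormOf_energyNorm_one_sub_smul_lt_one_iff hN hqcf ha hb (hpos _), fun α ↦
    pos_and_lt_two_div_of_opNormOf_epsNorm_one_sub_smul_lt_one hN hqcf ha hb (hpos _), ?_⟩
  rintro _ _ rfl rfl
  have hopt := iSup_abs_one_sub_two_div_add_mul ha hb (hpos _)
  refine ⟨(henergy _).trans hopt,
    fun α ↦ henergy α ▸ div_add_le_iSup_abs_one_sub_mul ha hb (hpos _) α,
    hopt ▸ heps (hcond.trans hκ_C) _, (heps hcond _).trans ?_,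
    le_trans ?_ (hlam.one_sub_le_sub_div_add hK hK_lt hphi2F.le hA ha hb),
    hlam.sub_div_add_le_one_sub hK hK_lt hphi2F.le hA ha.1 hb.1⟩
  · rw [hopt, mul_assoc, mul_left_comm]
    gcongr
    exact hlam.sub_div_add_le_three_mul_one_sub hK hK_lt hphi2F.le hA ha.1 hb.1
  · gcongr
    exact le_self_pow₀ hκ two_ne_zero
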